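/- For $0<\alpha\le 2$, $\alpha\ne 1$ and $|\beta|\le 1$ let $f(x;\alpha,\beta)$ be the (continuous) density of the standard stable law with characteristic function $$\Phi(t;\alpha,\beta)=\exp\Bigl(-|t|^{\alpha}\bigl\{1+i\beta(\operatorname{sgn}t)\tan\bigl(\tfrac{\pi\alpha}{2}\bigr)(|t|^{1-\alpha}-1)\bigr\}\Bigr),$$ that is, $f(x;\alpha,\beta)=\frac1{2\pi}\int_{\mathbf R}e^{-itx}\Phi(t;\alpha,\beta)\,dt$. Let $f(x;2)=\frac{1}{2\sqrt{\pi}}e^{-x^2/4}$ be the density of $N(0,2)$. Write $\Delta=2-\alpha$, $\zeta=-\beta\tan(\pi\alpha/2)$, $\beta^{*}=\beta\operatorname{sgn}(x-\zeta)$, and $$F_1(x;\alpha,\beta)=f(x-\zeta;2),\qquad F_2(x;\alpha,\beta)=(1+\beta^{*})\,\Delta\,|x-\zeta|^{\Delta-3},\qquad g=F_1+F_2 .$$ Fix $\beta$ with $-1<\beta<1$. Then: (1) For every $\epsilon>0$ there exist $\Delta_0>0$ and $x_0>0$ such that for all $0\le\Delta<\Delta_0$ and all $|x|>x_0$, $$\left|\frac{f(x;\alpha,\beta)}{g(x;\alpha,\beta)}-1\right|<\epsilon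 .$$ (2) For every $\delta>0$ and every $x_0>0$, as $\Delta\downarrow 0$, uniformly in $|x|>x_0$, $$g(x;\alpha,\beta)=\begin{cases}F_1(x;\alpha,\beta)\,\bigl(1+o(\Delta^{\delta/2})\bigr) & \text{if } |x-\zeta|\le(2-\delta)(\log 1/\Delta)^{1/2},\\[2pt] F_2(x;\alpha,\beta)\,\bigl(1+o(\Delta^{\delta/2})\bigr) & \text{if } |x-\zeta|\ge(2+\delta)(\log 1/\Delta)^{1/2}.\end{cases}$$ That is, for every $\eta>0$ there is $\Delta_1>0$ (depending on $\beta,\delta,x_0,\eta$) such that for all $0<\Delta<\Delta_1$ and all $|x|>x_0$: $|g/F_1-1|\le\eta\Delta^{\delta/2}$ in the first case, and $|g/F_2-1|\le\eta\Delta^{\delta/2}$ in the second. -/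

import Mathlib

/-- Characteristic function `Φ(t; α, β)` of the standard stable law (location `0`, scale `1`) in
Zolotarev's (M) parameterization. -/
noncomputable def stableCharFun (α β t : ℝ) : ℂ :=
  Complex.exp (-((|t| ^ α : ℝ) : ℂ) *
    (1 + Complex.I * ((β * SignType.sign t * Real.tan (Real.pi * α / 2) *
      (|t| ^ (1 - α) - 1) : ℝ) : ℂ)))

/-- The density `f(x; α, β)` of the standard stable law with characteristic function
`stableCharFun α β`, given by the Fourier inversion formula
`f(x) = (2π)⁻¹ ∫ exp(-itx) Φ(t; α, β) dt`. The integral is absolutely convergent because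
`‖Φ(t; α, β)‖ = exp(-|t|^α)`, and it is real because `Φ(-t)` is the conjugate of `Φ(t)`.
The lemma `eq_stableDensity` below shows that any continuous density of a finite measure with
characteristic function `Φ(·; α, β)` is this function. -/
noncomputable def stableDensity (α β x : ℝ) : ℝ :=
  (1 / (2 * Real.pi)) *
    (∫ t : ℝ, Complex.exp (-(Complex.I * ((t * x : ℝ) : ℂ))) * stableCharFun α β t).re

/-- `ζ = -β tan(πα/2)`. -/
noncomputable def stableShift (α β : ℝ) : ℝ := -β * Real.tan (Real.pi * α / 2)

/-- `f(x; 2)`, the density of `N(0, 2)`. -/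
noncomputable def normalTwoDensity (x : ℝ) : ℝ :=
  1 / (2 * Real.sqrt Real.pi) * Real.exp (-x ^ 2 / 4)

/-- `F₁(x; α, β) = f(x - ζ; 2)`. -/
noncomputable def gaussPart (α β x : ℝ) : ℝ := normalTwoDensity (x - stableShift α β)

/-- `F₂(x; α, β) = (1 + β*) Δ |x - ζ|^(Δ - 3)`, with `Δ = 2 - α` and `β* = β sgn(x - ζ)`. -/
noncomputable def tailPart (α β x : ℝ) : ℝ :=
  (1 + β * SignType.sign (x - stableShift α β)) * (2 - α) *
    |x - stableShift α β| ^ ((2 - α) - 3)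

/-- `g = F₁ + F₂`. -/
noncomputable def stableApprox (α β x : ℝ) : ℝ := gaussPart α β x + tailPart α β x

theorem norm_stableCharFun (α β t : ℝ) : ‖stableCharFun α β t‖ = Real.exp (-|t| ^ α) := by
  rw [stableCharFun, Complex.norm_exp]
  congr 1
  rw [← Complex.ofReal_neg, Complex.re_ofReal_mul]
  simp [-Complex.ofReal_mul]

theorem integrable_stableCharFun {α : ℝ} (hα : 0 < α) (β : ℝ) :
    MeasureTheory.Integrable (stableCharFun α β) := by
  have hs : Measurable (fun t : ℝ => ((SignType.sign t : SignType) : ℝ)) := by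
    have : (fun t : ℝ => ((SignType.sign t : SignType) : ℝ)) =
        fun t => if 0 < t then 1 else if t < 0 then -1 else 0 := by
      funext t
      rw [sign_apply]
      split_ifs <;> simp
    rw [this]
    exact Measurable.ite measurableSet_Ioi measurable_const
      (Measurable.ite measurableSet_Iio measurable_const measurable_const)
  have hm : Measurable (stableCharFun α β) := by
    unfold stableCharFun
    fun_prop
  have h0 : MeasureTheory.IntegrableOn (fun t : ℝ => Real.exp (-|t| ^ α)) (Set.Ioi 0) := by
    have := integrableOn_rpow_mul_exp_neg_rpow (s := 0) (p := α) (by norm_num) hα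
    refine this.congr_fun ?_ measurableSet_Ioi
    intro t ht
    simp [abs_of_pos (Set.mem_Ioi.1 ht)]
  have h1 : MeasureTheory.Integrable (fun t : ℝ => Real.exp (-|t| ^ α)) := by
    rw [← MeasureTheory.integrableOn_univ, ← Set.Iic_union_Ioi (a := (0 : ℝ))]
    refine MeasureTheory.IntegrableOn.union ?_ h0
    rw [integrableOn_Iic_iff_integrableOn_Iio]
    have h2 : MeasureTheory.IntegrableOn (fun t : ℝ => Real.exp (-|t| ^ α))
        (Set.Ioi (-(0 : ℝ))) := by simpa using h0
    simpa using h2.comp_neg_Iio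
  exact h1.mono' hm.aestronglyMeasurable (by simp [norm_stableCharFun])

theorem eq_stableDensity {α : ℝ} (hα : 0 < α) (β : ℝ) (h : ℝ → ℝ) (hc : Continuous h)
    (hn : ∀ x, 0 ≤ h x)
    (hfin : MeasureTheory.IsFiniteMeasure
      (MeasureTheory.volume.withDensity (fun x => ENNReal.ofReal (h x))))
    (hΦ : ∀ t, MeasureTheory.charFun
      (MeasureTheory.volume.withDensity (fun x => ENNReal.ofReal (h x))) t =
        stableCharFun α β t) :
    h = stableDensity α β := by
  have hi : MeasureTheory.Integrable h := by
    refine ⟨hc.aestronglyMeasurable, ?_⟩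
    rw [MeasureTheory.hasFiniteIntegral_iff_ofReal (Filter.Eventually.of_forall hn)]
    have := hfin.measure_univ_lt_top
    rwa [MeasureTheory.withDensity_apply _ MeasurableSet.univ,
      MeasureTheory.Measure.restrict_univ] at this
  have hF : FourierTransform.fourier (fun x => (h x : ℂ)) =
      fun w : ℝ => stableCharFun α β (-(2 * Real.pi) * w) := by
    funext w
    rw [← hΦ, MeasureTheory.charFun_apply_real,
      integral_withDensity_eq_integral_toReal_smul (by fun_prop) (by simp),
      Real.fourier_real_eq_integral_exp_smul]
    refine MeasureTheory.integral_congr_ae (Filter.Eventually.of_forall fun x => ?_)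
    simp only [ENNReal.toReal_ofReal (hn x), smul_eq_mul, Complex.real_smul]
    rw [mul_comm]
    congr 2
    push_cast
    ring
  have hne : -(2 * Real.pi) ≠ 0 := by
    have := Real.pi_pos
    linarith
  have hFi : MeasureTheory.Integrable (FourierTransform.fourier (fun x => (h x : ℂ))) := by
    rw [hF]
    exact (integrable_stableCharFun hα β).comp_mul_left' hne
  have hinv := Continuous.fourierInv_fourier_eq
    (f := fun x => (h x : ℂ)) (Complex.continuous_ofReal.comp hc) hi.ofReal hFi
  funext x
  have hx := congrFun hinv x
  rw [hF, Real.fourierInv_eq'] at hx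
  have hsub := MeasureTheory.Measure.integral_comp_mul_left
    (fun t : ℝ => Complex.exp (-(Complex.I * ((t * x : ℝ) : ℂ))) * stableCharFun α β t)
    (-(2 * Real.pi))
  have hcongr : (∫ v : ℝ, Complex.exp (((2 * Real.pi * inner ℝ v x : ℝ) : ℂ) * Complex.I) •
      stableCharFun α β (-(2 * Real.pi) * v)) =
      ∫ v : ℝ, Complex.exp (-(Complex.I * ((-(2 * Real.pi) * v * x : ℝ) : ℂ))) *
        stableCharFun α β (-(2 * Real.pi) * v) := by
    refine MeasureTheory.integral_congr_ae (Filter.Eventually.of_forall fun v => ?_)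
    simp only [smul_eq_mul]
    congr 2
    simp
    ring
  rw [hcongr, hsub] at hx
  have hre := congrArg Complex.re hx
  rw [Complex.ofReal_re, Complex.smul_re, smul_eq_mul, abs_inv, abs_neg,
    abs_of_pos (by positivity : 0 < 2 * Real.pi)] at hre
  rw [stableDensity, one_div, hre]

/-!
Write `α = 2 - Δ`, `θ = πΔ/2`, `y = x - ζ` and note `ζ = β tan θ`. In the (M) parameterization the
shift by `ζ` leaves a pure power: for `y > 0`

  `π f(x; α, β) = Re ∫₀^∞ exp (-ity - (1 + iζ) t ^ α) dt`,

and `π f(y; 2)` is the same integral with `α = 2`, `ζ = 0`. The idea is to turn the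
path of integration to the ray `arg t = -1/4`
(`integral_stableKernel_rotate`). There `exp (-ity)` decays like `exp (-|t| y sin (1/4))`, while
`(1 + iζ) t ^ α` and `t²` still have nonnegative real part, so that the behaviour for large `y` is
governed by the behaviour of the other factor at `t = 0`. In the difference of the stable and the
normal integrand, the linear terms `-(1 + iζ) t ^ α + t²` of the exponentials contribute Gamma
integrals (`integral_powerKernel`), whose real part is
`(1 + β) sin θ Γ(3 - Δ) y ^ (Δ - 3)`. What remains is `O(Δ (|t|³ + |t|⁵))`, because
`exp (-z) + z` is stationary at `0` and the two exponents differ by `O(Δ)` up to a power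
`|t| ^ (∓1/2)` (`norm_remainderKernel_le`); it contributes `O(Δ y⁻⁴)`. As
`sin θ Γ(3 - Δ) / π ~ Δ`, this yields, uniformly as `Δ → 0` and `y → ∞`,

  `f = F₁ + F₂ (1 + o(1))` (`abs_stableDensity_sub_le`, `hasDerivAt_tailConstant`),

which is stronger than `f / g → 1`. Negative `y` is reduced to positive `y` by the reflection
`f(-x; α, -β) = f(x; α, β)`.

The comparison of `F₁` with `F₂` is elementary: `exp (-y² / 4)` is a power of `Δ` when `|y|` is a
multiple of `√(log (1 / Δ))` (`stableApprox_regimes`).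
-/

/-! ### Contour shifts and exponential substitutions -/

open Complex MeasureTheory Filter Topology Set in
/-- Cauchy's theorem for an infinite horizontal strip: the integrals along `Im w = -a` and `Im w = -b`
agree when the integrand has an integrable majorant that vanishes at both ends. -/
theorem integral_horizontal_shift {H : ℂ → ℂ} (hH : Differentiable ℂ H) {a b : ℝ}
    {B : ℝ → ℝ} (hB : Integrable B) (hB₁ : Tendsto B atTop (𝓝 0)) (hB₂ : Tendsto B atBot (𝓝 0))
    (hbd : ∀ u : ℝ, ∀ ψ ∈ uIcc a b, ‖H (u - ψ * I)‖ ≤ B u) :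
    ∫ u : ℝ, H (u - a * I) = ∫ u : ℝ, H (u - b * I) := by
  have hc : Continuous H := hH.continuous
  have hint : ∀ ψ ∈ uIcc a b, Integrable (fun u : ℝ => H (u - ψ * I)) := fun ψ hψ =>
    hB.mono' (by fun_prop) (Eventually.of_forall fun u => hbd u ψ hψ)
  have hside : ∀ T : ℝ, ‖∫ s : ℝ in (-a)..(-b), H (T + s * I)‖ ≤ B T * |(-b) - (-a)| := fun T => by
    refine intervalIntegral.norm_integral_le_of_norm_le_const fun s hs => ?_
    have hs' : -s ∈ uIcc a b := by
      have := uIoc_subset_uIcc hs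
      rw [mem_uIcc] at this ⊢
      rcases this with h | h
      · right; constructor <;> linarith [h.1, h.2]
      · left; constructor <;> linarith [h.1, h.2]
    simpa using hbd T (-s) hs'
  have hz : ∀ l : Filter ℝ, Tendsto B l (𝓝 0) →
      Tendsto (fun T : ℝ => ∫ s : ℝ in (-a)..(-b), H (T + s * I)) l (𝓝 0) := fun l hl =>
    squeeze_zero_norm hside (by simpa using hl.mul_const _)
  have h1 := hz _ hB₁
  have h2 := (hz _ hB₂).comp tendsto_neg_atTop_atBot
  have hA := intervalIntegral_tendsto_integral (hint a left_mem_uIcc) tendsto_neg_atTop_atBot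
    tendsto_id
  have hB' := intervalIntegral_tendsto_integral (hint b right_mem_uIcc) tendsto_neg_atTop_atBot
    tendsto_id
  have key := ((hA.sub hB').add (h1.const_mul I)).sub (h2.const_mul I)
  have hzero : (fun T : ℝ => (((∫ u : ℝ in (-T)..(id T), H (u - a * I)) -
      ∫ u : ℝ in (-T)..(id T), H (u - b * I)) +
      I * ∫ s : ℝ in (-a)..(-b), H (T + s * I)) -
      I * ((fun T : ℝ => ∫ s : ℝ in (-a)..(-b), H (T + s * I)) ∘ Neg.neg) T) = fun _ => 0 := by
    funext T
    have := integral_boundary_rect_eq_zero_of_differentiableOn H ((-T : ℝ) + (-a : ℝ) * I)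
      ((T : ℝ) + (-b : ℝ) * I) hH.differentiableOn
    simpa [sub_eq_add_neg] using this
  rw [hzero] at key
  have := tendsto_nhds_unique key tendsto_const_nhds
  simpa [sub_eq_zero] using this

open MeasureTheory Set in
/-- The substitution `t = exp u` from the half-line to the line. -/
theorem integral_comp_exp_univ {E : Type*} [NormedAddCommGroup E] [NormedSpace ℝ E] (g : ℝ → E) :
    ∫ u : ℝ, Real.exp u • g (Real.exp u) = ∫ t in Ioi (0 : ℝ), g t := by
  have h := integral_image_eq_integral_abs_deriv_smul MeasurableSet.univ
    (fun x _ => (Real.hasDerivAt_exp x).hasDerivWithinAt) Real.exp_injective.injOn g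
  rw [image_univ, Real.range_exp] at h
  simpa [abs_of_pos (Real.exp_pos _)] using h.symm

open MeasureTheory Set in
theorem integrable_comp_exp_univ {E : Type*} [NormedAddCommGroup E] [NormedSpace ℝ E] (g : ℝ → E) :
    Integrable (fun u : ℝ => Real.exp u • g (Real.exp u)) ↔ IntegrableOn g (Ioi (0 : ℝ)) := by
  have h := integrableOn_image_iff_integrableOn_abs_deriv_smul MeasurableSet.univ
    (fun x _ => (Real.hasDerivAt_exp x).hasDerivWithinAt) Real.exp_injective.injOn g
  rw [image_univ, Real.range_exp] at h
  simpa [abs_of_pos (Real.exp_pos _)] using h.symm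

open MeasureTheory Set in
theorem integrable_exp_sub_exp {s p l : ℝ} (hs : 0 < s) (hp : 0 < p) (hl : 0 < l) :
    Integrable (fun u : ℝ => Real.exp (s * u - l * Real.exp (p * u))) := by
  have h := (integrable_comp_exp_univ _).2
    (integrableOn_rpow_mul_exp_neg_mul_rpow (s := s - 1) (p := p) (b := l) (by linarith) hp hl)
  refine h.congr (Filter.Eventually.of_forall fun u => ?_)
  simp only [smul_eq_mul]
  rw [← Real.exp_mul, ← Real.exp_mul, ← Real.exp_add, ← Real.exp_add, mul_comm u p]
  congr 1
  ring

open Filter Topology in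
theorem tendsto_exp_sub_exp_atTop {s p l : ℝ} (hp : 0 < p) (hl : 0 < l) :
    Tendsto (fun u : ℝ => Real.exp (s * u - l * Real.exp (p * u))) atTop (𝓝 0) := by
  have h := (tendsto_rpow_mul_exp_neg_mul_atTop_nhds_zero (s / p) l hl).comp
    (Real.tendsto_exp_atTop.comp (tendsto_id.const_mul_atTop hp))
  refine h.congr fun u => ?_
  simp only [Function.comp, id]
  rw [← Real.exp_mul, ← Real.exp_add]
  congr 1
  field_simp
  ring

open Filter Topology in
theorem tendsto_exp_sub_exp_atBot {s p l : ℝ} (hs : 0 < s) (hl : 0 < l) :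
    Tendsto (fun u : ℝ => Real.exp (s * u - l * Real.exp (p * u))) atBot (𝓝 0) := by
  refine squeeze_zero (fun _ => (Real.exp_pos _).le) (fun u => ?_)
    (Real.tendsto_exp_atBot.comp (tendsto_id.const_mul_atBot hs))
  simp only [Function.comp, id]
  gcongr
  have := mul_pos hl (Real.exp_pos (p * u))
  linarith

open MeasureTheory in
/-- Euler's integral for `Γ(s)` after the substitution `t = exp u`. -/
theorem integral_exp_sub_exp {s l : ℝ} (hs : 0 < s) (hl : 0 < l) :
    ∫ u : ℝ, Real.exp (s * u - l * Real.exp u) = (1 / l) ^ s * Real.Gamma s := by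
  rw [← Real.integral_rpow_mul_exp_neg_mul_Ioi hs hl, ← integral_comp_exp_univ]
  refine integral_congr_ae (Filter.Eventually.of_forall fun u => ?_)
  simp only [smul_eq_mul]
  rw [← Real.exp_mul, ← Real.exp_add, ← Real.exp_add]
  congr 1
  ring

/-! ### Lipschitz bounds for the exponential in a half-plane -/

theorem norm_exp_sub_exp_le {a b : ℂ} {m : ℝ} (ha : a.re ≤ m) (hb : b.re ≤ m) :
    ‖Complex.exp a - Complex.exp b‖ ≤ Real.exp m * ‖a - b‖ := by
  refine Convex.norm_image_sub_le_of_norm_hasDerivWithin_le (s := {z : ℂ | z.re ≤ m})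
    (fun z _ => (Complex.hasDerivAt_exp z).hasDerivWithinAt) (fun z hz => ?_)
    (convex_halfSpace_re_le m) hb ha
  rw [Complex.norm_exp]
  exact Real.exp_le_exp.2 hz

/-- On the right half-plane `exp (-z) + z` is Lipschitz with a constant as small as `‖z‖`, since its
derivative `1 - exp (-z)` vanishes at `0`. -/
theorem norm_exp_neg_add_sub_le {a b : ℂ} {N : ℝ} (ha : 0 ≤ a.re) (hb : 0 ≤ b.re)
    (haN : ‖a‖ ≤ N) (hbN : ‖b‖ ≤ N) :
    ‖(Complex.exp (-a) + a) - (Complex.exp (-b) + b)‖ ≤ N * ‖a - b‖ := by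
  refine Convex.norm_image_sub_le_of_norm_hasDerivWithin_le
    (s := {z : ℂ | 0 ≤ z.re} ∩ Metric.closedBall 0 N) (f := fun z => Complex.exp (-z) + z)
    (f' := fun z => Complex.exp (-z) * (-1) + 1)
    (fun z _ => (((hasDerivAt_neg z).cexp).add (hasDerivAt_id z)).hasDerivWithinAt) (fun z hz => ?_)
    ((convex_halfSpace_re_ge 0).inter (convex_closedBall 0 N)) ⟨hb, by simpa using hbN⟩
    ⟨ha, by simpa using haN⟩
  have h0 : (-z).re ≤ 0 := by simpa using hz.1
  have h := norm_exp_sub_exp_le (a := 0) (b := -z) (m := 0) (by simp) h0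
  have h2 : ‖z‖ ≤ N := by simpa using hz.2
  calc ‖Complex.exp (-z) * (-1) + 1‖ = ‖Complex.exp 0 - Complex.exp (-z)‖ := by
        rw [Complex.exp_zero]; congr 1; ring
    _ ≤ N := by simpa using h.trans (by simpa using h2)

/-! ### Rotated one-sided Fourier integrals -/

/-- The integrand `e^{-ity - (1 + iζ) t^α} dt` of the one-sided Fourier integral, in the coordinate
`t = e^w`. In this coordinate it is entire, and a ray `arg t = -ψ` becomes the line `Im w = -ψ`. -/
noncomputable def stableKernel (y α ζ : ℝ) (w : ℂ) : ℂ :=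
  Complex.exp (w - Complex.I * y * Complex.exp w - (1 + ζ * Complex.I) * Complex.exp (α * w))

/-- The integrand `t^α e^{-ity} dt` in the coordinate `t = e^w`. -/
noncomputable def powerKernel (y α : ℝ) (w : ℂ) : ℂ :=
  Complex.exp ((α + 1) * w - Complex.I * y * Complex.exp w)

theorem re_rotation (y u ψ : ℝ) :
    (Complex.I * y * Complex.exp (u - ψ * Complex.I)).re = y * Real.exp u * Real.sin ψ := by
  simp [Complex.exp_re, Complex.exp_im]
  ring

theorem re_power (α ζ u ψ : ℝ) :
    ((1 + ζ * Complex.I) * Complex.exp (α * (u - ψ * Complex.I))).re =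
      Real.exp (α * u) * (Real.cos (α * ψ) + ζ * Real.sin (α * ψ)) := by
  simp [Complex.exp_re, Complex.exp_im]
  ring

theorem half_exp_le_re_power {α ζ ψ : ℝ} (hα : 0 ≤ α) (hα2 : α ≤ 2) (hζ : |ζ| ≤ 1 / 4) (hψ : 0 ≤ ψ)
    (hψ2 : ψ ≤ 1 / 4) (u : ℝ) :
    1 / 2 * Real.exp (α * u) ≤
      ((1 + ζ * Complex.I) * Complex.exp (α * (u - ψ * Complex.I))).re := by
  rw [re_power, mul_comm]
  gcongr
  have h1 : 0 ≤ α * ψ := mul_nonneg hα hψ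
  have h2 : α * ψ ≤ 1 / 2 := by nlinarith
  have h3 := Real.one_sub_sq_div_two_le_cos (x := α * ψ)
  have h4 : |ζ * Real.sin (α * ψ)| ≤ 1 / 4 := by
    rw [abs_mul]
    nlinarith [Real.abs_sin_le_one (α * ψ), abs_nonneg ζ, abs_nonneg (Real.sin (α * ψ))]
  have h5 := (abs_le.1 h4).1
  nlinarith

/-- Re-routing the one-sided Fourier integral along the ray `arg t = -1/4`, on which `e^{-ity}`
decays exponentially while `e^{-(1 + iζ) t^α}` remains bounded. -/
theorem integral_stableKernel_rotate {y α ζ : ℝ} (hy : 0 < y) (hα : 0 < α) (hα2 : α ≤ 2)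
    (hζ : |ζ| ≤ 1 / 4) :
    ∫ u : ℝ, stableKernel y α ζ (u - (0 : ℝ) * Complex.I) =
      ∫ u : ℝ, stableKernel y α ζ (u - (1 / 4 : ℝ) * Complex.I) := by
  refine integral_horizontal_shift (B := fun u => Real.exp (1 * u - 1 / 2 * Real.exp (α * u)))
    (by unfold stableKernel; fun_prop) (integrable_exp_sub_exp one_pos hα (by norm_num))
    (tendsto_exp_sub_exp_atTop hα (by norm_num)) (tendsto_exp_sub_exp_atBot one_pos (by norm_num))
    fun u ψ hψ => ?_
  rw [Set.uIcc_of_le (by norm_num)] at hψ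
  rw [stableKernel, Complex.norm_exp, Complex.sub_re, Complex.sub_re, re_rotation]
  have h := half_exp_le_re_power hα.le hα2 hζ hψ.1 hψ.2 u
  have h2 : 0 ≤ y * Real.exp u * Real.sin ψ := by
    have := Real.sin_nonneg_of_nonneg_of_le_pi hψ.1 (by linarith [hψ.2, Real.pi_gt_three])
    positivity
  have h3 : ((u : ℂ) - ψ * Complex.I).re = u := by simp
  rw [h3]
  gcongr
  linarith

theorem norm_powerKernel (y α u ψ : ℝ) :
    ‖powerKernel y α (u - ψ * Complex.I)‖ =
      Real.exp ((α + 1) * u - y * Real.sin ψ * Real.exp u) := by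
  rw [powerKernel, Complex.norm_exp, Complex.sub_re, re_rotation]
  congr 1
  simp
  ring

/-- The integral of `t^α e^{-ity}` along a ray in the open fourth quadrant; turning the ray to the
negative imaginary axis makes it Euler's integral. -/
theorem integral_powerKernel {y α φ : ℝ} (hy : 0 < y) (hα : -1 < α) (hφ : 0 < φ)
    (hφ2 : φ ≤ Real.pi / 2) :
    ∫ u : ℝ, powerKernel y α (u - φ * Complex.I) =
      Complex.exp (-(((α + 1) * (Real.pi / 2) : ℝ) : ℂ) * Complex.I) *
        (((1 / y) ^ (α + 1) * Real.Gamma (α + 1) : ℝ) : ℂ) := by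
  have hs : 0 < Real.sin φ := Real.sin_pos_of_pos_of_lt_pi hφ (by linarith [Real.pi_pos])
  have hl : 0 < y * Real.sin φ := mul_pos hy hs
  have ha : 0 < α + 1 := by linarith
  rw [integral_horizontal_shift (b := Real.pi / 2)
    (B := fun u => Real.exp ((α + 1) * u - y * Real.sin φ * Real.exp (1 * u)))
    (by unfold powerKernel; fun_prop) (integrable_exp_sub_exp ha one_pos hl)
    (tendsto_exp_sub_exp_atTop one_pos hl) (tendsto_exp_sub_exp_atBot ha hl) fun u ψ hψ => ?_]
  · rw [← integral_exp_sub_exp ha hy, ← integral_complex_ofReal, ← MeasureTheory.integral_const_mul]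
    congr 1
    funext u
    rw [Complex.ofReal_exp, ← Complex.exp_add, powerKernel, Complex.exp_sub ↑u]
    have hI : Complex.exp (((Real.pi / 2 : ℝ) : ℂ) * Complex.I) = Complex.I := by
      push_cast; exact Complex.exp_pi_div_two_mul_I
    rw [hI]
    congr 1
    push_cast
    field_simp
    ring
  · rw [Set.uIcc_of_le hφ2] at hψ
    rw [norm_powerKernel, one_mul]
    have := Real.sin_le_sin_of_le_of_le_pi_div_two (by linarith [Real.pi_pos]) hψ.2 hψ.1
    gcongr

theorem integrable_powerKernel {y α φ : ℝ} (hy : 0 < y) (hα : -1 < α) (hφ : 0 < φ)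
    (hφ2 : φ ≤ Real.pi / 2) :
    MeasureTheory.Integrable (fun u : ℝ => powerKernel y α (u - φ * Complex.I)) := by
  have hs : 0 < Real.sin φ := Real.sin_pos_of_pos_of_lt_pi hφ (by linarith [Real.pi_pos])
  refine (integrable_exp_sub_exp (s := α + 1) (p := 1) (by linarith) one_pos
    (mul_pos hy hs)).mono' ?_ (Filter.Eventually.of_forall fun u => ?_)
  · unfold powerKernel
    exact Continuous.aestronglyMeasurable (by fun_prop)
  · rw [norm_powerKernel, one_mul]

theorem integrable_stableKernel {y α ζ : ℝ} (hy : 0 < y) (hα : 0 < α) (hα2 : α ≤ 2)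
    (hζ : |ζ| ≤ 1 / 4) :
    MeasureTheory.Integrable (fun u : ℝ => stableKernel y α ζ (u - (1 / 4 : ℝ) * Complex.I)) := by
  refine (integrable_exp_sub_exp (s := 1) (p := 1) one_pos one_pos
    (mul_pos hy (Real.sin_pos_of_pos_of_lt_pi (x := 1 / 4) (by norm_num)
      (by linarith [Real.pi_gt_three])))).mono' ?_ (Filter.Eventually.of_forall fun u => ?_)
  · unfold stableKernel
    exact Continuous.aestronglyMeasurable (by fun_prop)
  · rw [stableKernel, Complex.norm_exp, Complex.sub_re, Complex.sub_re, re_rotation]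
    have h := half_exp_le_re_power hα.le hα2 hζ (ψ := 1 / 4) (by norm_num) le_rfl u
    have h3 : ((u : ℂ) - (1 / 4 : ℝ) * Complex.I).re = u := by simp
    have := Real.exp_pos (α * u)
    rw [h3]
    refine Real.exp_le_exp.2 ?_
    rw [one_mul]
    linarith

/-- On the ray, the exponents `t ^ (2 - Δ)` (times `1 + iζ`) and `t ^ 2` differ by `O(Δ)`, with a
loss of at most `|t| ^ (∓1/2)` from the logarithm. -/
theorem norm_exponent_sub_le {Δ ζ m u : ℝ} (hΔ : 0 ≤ Δ) (hζ : |ζ| ≤ 4 * Δ)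
    (h1 : (2 - Δ) * u ≤ m) (h2 : 2 * u ≤ m) :
    ‖(1 + ζ * Complex.I) * Complex.exp (((2 - Δ : ℝ) : ℂ) * (u - (1 / 4 : ℝ) * Complex.I)) -
      Complex.exp (2 * (u - (1 / 4 : ℝ) * Complex.I))‖ ≤
      7 * Δ * Real.exp (|u| / 2) * Real.exp m := by
  set w : ℂ := u - (1 / 4 : ℝ) * Complex.I with hw
  have hre : w.re = u := by simp [hw]
  have r1 : (((2 - Δ : ℝ) : ℂ) * w).re = (2 - Δ) * u := by rw [Complex.re_ofReal_mul, hre]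
  have r2 : ((2 : ℂ) * w).re = 2 * u := by
    have := Complex.re_ofReal_mul 2 w
    rw [hre] at this
    simpa using this
  have hwn : ‖w‖ ≤ 3 * Real.exp (|u| / 2) := by
    have : ‖w‖ ≤ |u| + 1 / 4 := by
      rw [hw]
      refine (norm_sub_le _ _).trans ?_
      simp
    have := Real.add_one_le_exp (|u| / 2)
    have := abs_nonneg u
    linarith
  have hone : 1 ≤ Real.exp (|u| / 2) := Real.one_le_exp (by positivity)
  have e1 : ‖(ζ * Complex.I) * Complex.exp (((2 - Δ : ℝ) : ℂ) * w)‖ ≤ 4 * Δ * Real.exp m := by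
    rw [norm_mul, Complex.norm_exp, r1]
    have : ‖(ζ : ℂ) * Complex.I‖ = |ζ| := by simp
    rw [this]
    gcongr
  have e2 : ‖Complex.exp (((2 - Δ : ℝ) : ℂ) * w) - Complex.exp (2 * w)‖ ≤
      Real.exp m * (Δ * ‖w‖) := by
    refine (norm_exp_sub_exp_le (r1.trans_le h1) (r2.trans_le h2)).trans_eq ?_
    have : ((2 - Δ : ℝ) : ℂ) * w - 2 * w = (-Δ : ℝ) * w := by push_cast; ring
    rw [this, norm_mul, Complex.norm_real, Real.norm_eq_abs, abs_neg, abs_of_nonneg hΔ]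
  have hsplit : (1 + ζ * Complex.I) * Complex.exp (((2 - Δ : ℝ) : ℂ) * w) - Complex.exp (2 * w) =
      (ζ * Complex.I) * Complex.exp (((2 - Δ : ℝ) : ℂ) * w) +
      (Complex.exp (((2 - Δ : ℝ) : ℂ) * w) - Complex.exp (2 * w)) := by ring
  rw [hsplit]
  have hm := Real.exp_pos m
  have e3 : Real.exp m * (Δ * ‖w‖) ≤ Real.exp m * (Δ * (3 * Real.exp (|u| / 2))) := by gcongr
  have e4 : 4 * Δ * Real.exp m * 1 ≤ 4 * Δ * Real.exp m * Real.exp (|u| / 2) := by gcongr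
  refine (norm_add_le _ _).trans ?_
  linarith

/-- The part of `stableKernel` that is left after comparison with the Gaussian kernel and removal
of the linear terms of both exponentials. -/
noncomputable def remainderKernel (y Δ ζ : ℝ) (w : ℂ) : ℂ :=
  (stableKernel y (2 - Δ) ζ w + (1 + ζ * Complex.I) * powerKernel y (2 - Δ) w) -
    (stableKernel y 2 0 w + powerKernel y 2 w)

/-- The two exponents differ by `O(Δ)`, and `exp (-z) + z` is stationary at `0`; since `2 - Δ` is close
to `2`, the remainder vanishes at least like `t ^ 3` at the origin, one power beyond the terms removed.
The extra factor `exp u` comes from `dt = exp u du`. -/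
theorem norm_remainderKernel_le {y Δ ζ : ℝ} (hΔ : 0 ≤ Δ) (hΔ1 : Δ ≤ 1 / 16)
    (hζ : |ζ| ≤ 4 * Δ) (u : ℝ) :
    ‖remainderKernel y Δ ζ (u - (1 / 4 : ℝ) * Complex.I)‖ ≤
      14 * Δ * (Real.exp (4 * u - y * Real.sin (1 / 4) * Real.exp u) +
        Real.exp (6 * u - y * Real.sin (1 / 4) * Real.exp u)) := by
  set w : ℂ := u - (1 / 4 : ℝ) * Complex.I with hw
  set a : ℂ := (1 + ζ * Complex.I) * Complex.exp (((2 - Δ : ℝ) : ℂ) * w) with ha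
  set b : ℂ := Complex.exp (2 * w) with hb
  have hζ4 : |ζ| ≤ 1 / 4 := by linarith
  have hre : w.re = u := by simp [hw]
  have hfac : remainderKernel y Δ ζ w = Complex.exp (w - Complex.I * y * Complex.exp w) *
      ((Complex.exp (-a) + a) - (Complex.exp (-b) + b)) := by
    have e1 : stableKernel y (2 - Δ) ζ w =
        Complex.exp (w - Complex.I * y * Complex.exp w) * Complex.exp (-a) := by
      rw [stableKernel, ← Complex.exp_add, ha]; congr 1
    have e2 : stableKernel y 2 0 w =
        Complex.exp (w - Complex.I * y * Complex.exp w) * Complex.exp (-b) := by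
      rw [stableKernel, ← Complex.exp_add, hb]; congr 1; simp; ring
    have e3 : (1 + ζ * Complex.I) * powerKernel y (2 - Δ) w =
        Complex.exp (w - Complex.I * y * Complex.exp w) * a := by
      rw [powerKernel, ha, mul_left_comm, ← Complex.exp_add]; congr 2; ring
    have e4 : powerKernel y 2 w = Complex.exp (w - Complex.I * y * Complex.exp w) * b := by
      rw [powerKernel, hb, ← Complex.exp_add]; congr 1; push_cast; ring
    rw [remainderKernel, e1, e2, e3, e4]; ring
  have hnorm : ‖Complex.exp (w - Complex.I * y * Complex.exp w)‖ =
      Real.exp (u - y * Real.sin (1 / 4) * Real.exp u) := by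
    rw [Complex.norm_exp, Complex.sub_re, hw, re_rotation, ← hw, hre]; congr 1; ring
  have ha0 : 0 ≤ a.re := by
    refine le_trans ?_ (half_exp_le_re_power (by linarith) (by linarith) hζ4 (by norm_num) le_rfl u)
    positivity
  have hb0 : 0 ≤ b.re := by
    have h := half_exp_le_re_power (α := 2) (ζ := 0) (ψ := 1 / 4) (by norm_num) le_rfl (by norm_num)
      (by norm_num) le_rfl u
    have h' : (1 + ((0 : ℝ) : ℂ) * Complex.I) *
        Complex.exp (((2 : ℝ) : ℂ) * (u - ((1 / 4 : ℝ) : ℂ) * Complex.I)) = b := by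
      rw [hb, hw]; push_cast; ring_nf
    rw [h'] at h
    exact le_trans (by positivity) h
  have hcn : ‖1 + (ζ : ℂ) * Complex.I‖ ≤ 2 := by
    refine (norm_add_le _ _).trans ?_
    simp
    linarith
  -- `m` bounds the logarithms of the moduli of both exponents, and `exp k` bounds
  -- the resulting power of `|t| = exp u`.
  have main : ∀ m k : ℝ, (2 - Δ) * u ≤ m → 2 * u ≤ m → |u| / 2 + m + m + u ≤ k →
      ‖remainderKernel y Δ ζ w‖ ≤ 14 * Δ * Real.exp (k - y * Real.sin (1 / 4) * Real.exp u) := by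
    intro m k h1 h2 hk
    have han : ‖a‖ ≤ 2 * Real.exp m := by
      rw [ha, norm_mul, Complex.norm_exp, Complex.re_ofReal_mul, hre]
      gcongr
    have hbn : ‖b‖ ≤ 2 * Real.exp m := by
      have : ((2 : ℂ) * w).re = 2 * u := by
        have := Complex.re_ofReal_mul 2 w
        rw [hre] at this
        simpa using this
      rw [hb, Complex.norm_exp, this]
      have := Real.exp_le_exp.2 h2
      have := Real.exp_pos m
      linarith
    have h := norm_exp_neg_add_sub_le ha0 hb0 han hbn
    have hab : ‖a - b‖ ≤ 7 * Δ * Real.exp (|u| / 2) * Real.exp m := norm_exponent_sub_le hΔ hζ h1 h2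
    rw [hfac, norm_mul, hnorm]
    calc _ ≤ Real.exp (u - y * Real.sin (1 / 4) * Real.exp u) *
          (2 * Real.exp m * (7 * Δ * Real.exp (|u| / 2) * Real.exp m)) := by
            gcongr
            exact h.trans (by gcongr)
      _ = 14 * Δ * Real.exp ((|u| / 2 + m + m + u) - y * Real.sin (1 / 4) * Real.exp u) := by
            have : (|u| / 2 + m + m + u) - y * Real.sin (1 / 4) * Real.exp u =
              (u - y * Real.sin (1 / 4) * Real.exp u) + m + (|u| / 2) + m := by ring
            rw [this, Real.exp_add, Real.exp_add, Real.exp_add]; ring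
      _ ≤ _ := by gcongr
  rw [mul_add]
  have p1 := Real.exp_pos (4 * u - y * Real.sin (1 / 4) * Real.exp u)
  have p2 := Real.exp_pos (6 * u - y * Real.sin (1 / 4) * Real.exp u)
  rcases le_total u 0 with hu | hu
  · have := main ((2 - Δ) * u) (4 * u) le_rfl (by nlinarith)
      (by rw [abs_of_nonpos hu]; nlinarith)
    nlinarith [mul_nonneg hΔ p2.le]
  · have := main (2 * u) (6 * u) (by nlinarith) le_rfl (by rw [abs_of_nonneg hu]; linarith)
    nlinarith [mul_nonneg hΔ p1.le]

theorem norm_integral_remainderKernel_le {y Δ ζ : ℝ} (hy : 1 ≤ y) (hΔ : 0 ≤ Δ)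
    (hΔ1 : Δ ≤ 1 / 16) (hζ : |ζ| ≤ 4 * Δ) :
    ‖∫ u : ℝ, remainderKernel y Δ ζ (u - (1 / 4 : ℝ) * Complex.I)‖ ≤
      14 * (6 / Real.sin (1 / 4) ^ 4 + 120 / Real.sin (1 / 4) ^ 6) * Δ / y ^ 4 := by
  have hs : 0 < Real.sin (1 / 4) := Real.sin_pos_of_pos_of_lt_pi (by norm_num)
    (by linarith [Real.pi_gt_three])
  have hy0 : 0 < y := by linarith
  have hl : 0 < y * Real.sin (1 / 4) := mul_pos hy0 hs
  have i1 := integrable_exp_sub_exp (s := 4) (p := 1) (by norm_num) one_pos hl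
  have i2 := integrable_exp_sub_exp (s := 6) (p := 1) (by norm_num) one_pos hl
  simp only [one_mul] at i1 i2
  refine (MeasureTheory.norm_integral_le_of_norm_le ((i1.add i2).const_mul (14 * Δ))
    (Filter.Eventually.of_forall fun u => norm_remainderKernel_le hΔ hΔ1 hζ u)).trans ?_
  simp only [Pi.add_apply]
  rw [MeasureTheory.integral_const_mul, MeasureTheory.integral_add i1 i2,
    integral_exp_sub_exp (by norm_num) hl, integral_exp_sub_exp (by norm_num) hl]
  have g4 : Real.Gamma 4 = 6 := by
    rw [Real.Gamma_ofNat_eq_factorial 3]; norm_num [Nat.factorial]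
  have g6 : Real.Gamma 6 = 120 := by
    rw [Real.Gamma_ofNat_eq_factorial 5]; norm_num [Nat.factorial]
  rw [g4, g6]
  have r4 : (1 / (y * Real.sin (1 / 4))) ^ (4 : ℝ) = 1 / (y ^ 4 * Real.sin (1 / 4) ^ 4) := by
    rw [show (4 : ℝ) = ((4 : ℕ) : ℝ) by norm_num, Real.rpow_natCast]
    rw [one_div, inv_pow, mul_pow, one_div]
    norm_num
  have r6 : (1 / (y * Real.sin (1 / 4))) ^ (6 : ℝ) ≤ 1 / (y ^ 4 * Real.sin (1 / 4) ^ 6) := by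
    rw [show (6 : ℝ) = ((6 : ℕ) : ℝ) by norm_num, Real.rpow_natCast]
    rw [one_div, inv_pow, mul_pow, ← one_div]
    gcongr
    norm_num
  rw [r4]
  calc _ ≤ 14 * Δ * (1 / (y ^ 4 * Real.sin (1 / 4) ^ 4) * 6 +
        1 / (y ^ 4 * Real.sin (1 / 4) ^ 6) * 120) := by gcongr
    _ = _ := by field_simp

/-- The one-sided Fourier integral differs from its Gaussian counterpart by an explicit multiple of
`y ^ (Δ - 3)`, up to `O(Δ y⁻⁴)`. -/
theorem abs_re_integral_stableKernel_sub_le {y Δ ζ : ℝ} (hy : 1 ≤ y) (hΔ : 0 ≤ Δ)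
    (hΔ1 : Δ ≤ 1 / 16) (hζ : |ζ| ≤ 4 * Δ) :
    |(∫ u : ℝ, stableKernel y (2 - Δ) ζ (u - (0 : ℝ) * Complex.I)).re -
      (∫ u : ℝ, stableKernel y 2 0 (u - (0 : ℝ) * Complex.I)).re -
      (Real.sin (Real.pi * Δ / 2) + ζ * Real.cos (Real.pi * Δ / 2)) * Real.Gamma (3 - Δ) *
        y ^ (Δ - 3)| ≤
      14 * (6 / Real.sin (1 / 4) ^ 4 + 120 / Real.sin (1 / 4) ^ 6) * Δ / y ^ 4 := by
  have hy0 : 0 < y := by linarith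
  have hζ4 : |ζ| ≤ 1 / 4 := by linarith
  have hφ : (0 : ℝ) < 1 / 4 := by norm_num
  have hφ2 : (1 / 4 : ℝ) ≤ Real.pi / 2 := by linarith [Real.pi_gt_three]
  have hα : (0 : ℝ) < 2 - Δ := by linarith
  have hα1 : (-1 : ℝ) < 2 - Δ := by linarith
  have hz : |(0 : ℝ)| ≤ 1 / 4 := by norm_num
  refine le_trans ?_ (norm_integral_remainderKernel_le hy hΔ hΔ1 hζ)
  refine le_trans (le_of_eq ?_) (Complex.abs_re_le_norm _)
  unfold remainderKernel
  have i1 := integrable_stableKernel hy0 hα (by linarith) hζ4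
  have i2 := integrable_stableKernel hy0 (by norm_num : (0 : ℝ) < 2) le_rfl hz
  have j1 := (integrable_powerKernel hy0 hα1 hφ hφ2).const_mul (1 + ζ * Complex.I)
  have j2 := integrable_powerKernel (α := 2) hy0 (by norm_num) hφ hφ2
  have hsub := MeasureTheory.integral_sub (i1.add j1) (i2.add j2)
  simp only [Pi.add_apply] at hsub
  rw [hsub, MeasureTheory.integral_add i1 j1,
    MeasureTheory.integral_add i2 j2, MeasureTheory.integral_const_mul,
    ← integral_stableKernel_rotate hy0 hα (by linarith) hζ4,
    ← integral_stableKernel_rotate hy0 (by norm_num : (0 : ℝ) < 2) le_rfl hz,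
    integral_powerKernel hy0 hα1 hφ hφ2, integral_powerKernel (α := 2) hy0 (by norm_num) hφ hφ2,
    ← Complex.ofReal_neg, ← Complex.ofReal_neg]
  have c1 : Real.cos (-((2 - Δ + 1) * (Real.pi / 2))) = -Real.sin (Real.pi * Δ / 2) := by
    rw [Real.cos_neg, show (2 - Δ + 1) * (Real.pi / 2) =
      (Real.pi / 2 - Real.pi * Δ / 2) + Real.pi by ring, Real.cos_add_pi, Real.cos_pi_div_two_sub]
  have s1 : Real.sin (-((2 - Δ + 1) * (Real.pi / 2))) = Real.cos (Real.pi * Δ / 2) := by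
    rw [Real.sin_neg, show (2 - Δ + 1) * (Real.pi / 2) =
      (Real.pi / 2 - Real.pi * Δ / 2) + Real.pi by ring, Real.sin_add_pi, Real.sin_pi_div_two_sub,
      neg_neg]
  have c2 : Real.cos (-((2 + 1) * (Real.pi / 2))) = 0 := by
    rw [Real.cos_neg, show ((2 : ℝ) + 1) * (Real.pi / 2) = Real.pi / 2 + Real.pi by ring,
      Real.cos_add_pi, Real.cos_pi_div_two, neg_zero]
  have hpow : (1 / y) ^ (2 - Δ + 1) = y ^ (Δ - 3) := by
    rw [one_div, Real.inv_rpow hy0.le, ← Real.rpow_neg hy0.le]; congr 1; ring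
  have hG : (2 - Δ + 1 : ℝ) = 3 - Δ := by ring
  have e1 : ((1 + ζ * Complex.I) *
      (Complex.exp (((-((2 - Δ + 1) * (Real.pi / 2)) : ℝ) : ℂ) * Complex.I) *
        (((1 / y) ^ (2 - Δ + 1) * Real.Gamma (2 - Δ + 1) : ℝ) : ℂ))).re =
      -(Real.sin (Real.pi * Δ / 2) + ζ * Real.cos (Real.pi * Δ / 2)) * Real.Gamma (3 - Δ) *
        y ^ (Δ - 3) := by
    rw [← mul_assoc, Complex.re_mul_ofReal, Complex.mul_re, Complex.exp_ofReal_mul_I_re,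
      Complex.exp_ofReal_mul_I_im, c1, s1, hpow, hG]
    simp
    ring
  have e2 : (Complex.exp (((-((2 + 1) * (Real.pi / 2)) : ℝ) : ℂ) * Complex.I) *
        (((1 / y) ^ ((2 : ℝ) + 1) * Real.Gamma (2 + 1) : ℝ) : ℂ)).re = 0 := by
    rw [Complex.re_mul_ofReal, Complex.exp_ofReal_mul_I_re, c2, zero_mul]
  rw [Complex.sub_re, Complex.add_re, Complex.add_re, e1, e2]
  congr 1
  ring

/-! ### Stable densities as one-sided Fourier integrals -/

theorem stableShift_two_sub (Δ β : ℝ) :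
    stableShift (2 - Δ) β = β * Real.tan (Real.pi * Δ / 2) := by
  rw [stableShift, show Real.pi * (2 - Δ) / 2 = Real.pi - Real.pi * Δ / 2 by ring,
    Real.tan_pi_sub]
  ring

/-- The centring at `ζ` is exactly what turns the (M) parameterization into the pure power
`(1 + iζ) t ^ α` on the positive half-line. -/
theorem exp_mul_stableCharFun_of_pos (α β x : ℝ) {t : ℝ} (ht : 0 < t) :
    Complex.exp (-(Complex.I * ((t * x : ℝ) : ℂ))) * stableCharFun α β t =
      Complex.exp (-(Complex.I * ((t * (x - stableShift α β) : ℝ) : ℂ)) -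
        (1 + stableShift α β * Complex.I) * ((t ^ α : ℝ) : ℂ)) := by
  have h1 : t ^ α * (t ^ (1 - α) - 1) = t - t ^ α := by
    rw [mul_sub, ← Real.rpow_add ht]; simp
  rw [stableCharFun, ← Complex.exp_add, abs_of_pos ht, sign_pos ht, stableShift]
  congr 1
  have h2 : ((t ^ α : ℝ) : ℂ) * (((t ^ (1 - α) : ℝ) : ℂ) - 1) = t - ((t ^ α : ℝ) : ℂ) := by
    exact_mod_cast h1
  rw [show ((1 : SignType) : ℝ) = 1 from rfl]
  push_cast at h2 ⊢
  linear_combination (-Complex.I * β * Complex.tan (Real.pi * α / 2)) * h2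

theorem stableCharFun_neg_apply (α β t : ℝ) :
    stableCharFun α β (-t) = (starRingEnd ℂ) (stableCharFun α β t) := by
  rw [stableCharFun, stableCharFun, ← Complex.exp_conj]
  congr 1
  simp [-Complex.ofReal_mul, Left.sign_neg]

theorem stableCharFun_neg_param (α β t : ℝ) :
    stableCharFun α (-β) t = stableCharFun α β (-t) := by
  rw [stableCharFun, stableCharFun]
  simp [Left.sign_neg]

/-- Reflection: `f(-x; α, -β) = f(x; α, β)`. -/
theorem stableDensity_neg (α β x : ℝ) : stableDensity α (-β) (-x) = stableDensity α β x := by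
  rw [stableDensity, stableDensity]
  congr 2
  rw [← MeasureTheory.integral_neg_eq_self]
  congr 1
  funext t
  rw [stableCharFun_neg_param, neg_neg]
  simp

open MeasureTheory Set in
theorem stableDensity_eq_integral_Ioi {α : ℝ} (hα : 0 < α) (β x : ℝ) :
    stableDensity α β x = 1 / Real.pi * (∫ t in Ioi (0 : ℝ),
      Complex.exp (-(Complex.I * ((t * x : ℝ) : ℂ))) * stableCharFun α β t).re := by
  set F : ℝ → ℂ := fun t => Complex.exp (-(Complex.I * ((t * x : ℝ) : ℂ))) * stableCharFun α β t
    with hF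
  have hnorm : ∀ t : ℝ, ‖Complex.exp (-(Complex.I * ((t * x : ℝ) : ℂ)))‖ = 1 := fun t => by
    rw [Complex.norm_exp]; simp [-Complex.ofReal_mul]
  have hi : Integrable F := by
    refine (integrable_stableCharFun hα β).bdd_mul (c := 1) ?_
      (Filter.Eventually.of_forall fun t => (hnorm t).le)
    exact Continuous.aestronglyMeasurable (by fun_prop)
  have hconj : ∀ t, F (-t) = (starRingEnd ℂ) (F t) := fun t => by
    simp only [hF]
    rw [stableCharFun_neg_apply, map_mul, ← Complex.exp_conj]
    congr 2
    simp
  have hre : ∀ t, (F t).re = (F |t|).re := fun t => by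
    rcases abs_choice t with h | h <;> rw [h]
    rw [hconj]; simp
  have h1 : (∫ t, F t).re = ∫ t, (F t).re := (integral_re hi).symm
  have h2 : (∫ t in Ioi (0 : ℝ), F t).re = ∫ t in Ioi (0 : ℝ), (F t).re :=
    (integral_re hi.integrableOn).symm
  have h3 : ∫ t, (F t).re = 2 * ∫ t in Ioi (0 : ℝ), (F t).re := by
    rw [← integral_comp_abs (f := fun t => (F t).re)]
    exact integral_congr_ae (Filter.Eventually.of_forall hre)
  rw [stableDensity, h1, h2, h3]
  field_simp

theorem stableDensity_eq_integral_stableKernel {α : ℝ} (hα : 0 < α) (β x : ℝ) :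
    stableDensity α β x = 1 / Real.pi *
      (∫ u : ℝ, stableKernel (x - stableShift α β) α (stableShift α β)
        (u - (0 : ℝ) * Complex.I)).re := by
  rw [stableDensity_eq_integral_Ioi hα, ← integral_comp_exp_univ]
  congr 3
  funext u
  rw [exp_mul_stableCharFun_of_pos α β x (Real.exp_pos u), stableKernel, Complex.real_smul,
    Complex.ofReal_exp, ← Complex.exp_add]
  congr 1
  rw [← Real.exp_mul, mul_comm u α]
  push_cast
  ring_nf

theorem stableDensity_two (β x : ℝ) : stableDensity 2 β x = normalTwoDensity x := by
  have h := fourierIntegral_gaussian (b := 1) (by simp) (-(x : ℂ))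
  have hpi : ((Real.pi : ℂ) / 1) ^ (1 / 2 : ℂ) = ((Real.sqrt Real.pi : ℝ) : ℂ) := by
    rw [Real.sqrt_eq_rpow, Complex.ofReal_cpow Real.pi_pos.le]; simp
  rw [hpi] at h
  have hint : (∫ t : ℝ, Complex.exp (-(Complex.I * ((t * x : ℝ) : ℂ))) * stableCharFun 2 β t) =
      ((Real.sqrt Real.pi * Real.exp (-x ^ 2 / 4) : ℝ) : ℂ) := by
    push_cast
    convert h using 1
    · congr 1
      funext t
      congr 2
      · ring
      · have : Real.tan (Real.pi * 2 / 2) = 0 := by simp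
        rw [stableCharFun, this]
        simp
    · congr 2
      ring
  rw [stableDensity, hint, Complex.ofReal_re, normalTwoDensity]
  have hs := Real.mul_self_sqrt Real.pi_pos.le
  have hs0 : 0 < Real.sqrt Real.pi := Real.sqrt_pos.2 Real.pi_pos
  nth_rewrite 1 [← hs]
  field_simp

/-- The standard normal-type density as a one-sided integral, which makes it comparable with the
stable densities kernel by kernel. -/
theorem normalTwoDensity_eq_integral_stableKernel (y : ℝ) :
    normalTwoDensity y = 1 / Real.pi *
      (∫ u : ℝ, stableKernel y 2 0 (u - (0 : ℝ) * Complex.I)).re := by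
  have h := stableDensity_eq_integral_stableKernel (α := 2) (by norm_num) 0 y
  have h0 : stableShift 2 0 = 0 := by simp [stableShift]
  rwa [stableDensity_two, h0, sub_zero] at h

/-! ### Ratio of the stable density to its approximation -/

theorem abs_stableShift_le {Δ β : ℝ} (hΔ : 0 ≤ Δ) (hΔ1 : Δ ≤ 1 / 16) (hβ : |β| ≤ 1) :
    |stableShift (2 - Δ) β| ≤ 4 * Δ := by
  have hpi := Real.pi_pos
  have hpi4 := Real.pi_le_four
  have hθ : 0 ≤ Real.pi * Δ / 2 := by positivity
  have hθ2 : Real.pi * Δ / 2 ≤ 2 * Δ := by nlinarith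
  have hcos : 1 / 2 ≤ Real.cos (Real.pi * Δ / 2) := by
    have := Real.one_sub_sq_div_two_le_cos (x := Real.pi * Δ / 2)
    nlinarith
  have hsin := Real.sin_le hθ
  have hsin0 := Real.sin_nonneg_of_nonneg_of_le_pi hθ (by nlinarith [Real.pi_gt_three])
  have htan : |Real.tan (Real.pi * Δ / 2)| ≤ 4 * Δ := by
    rw [Real.tan_eq_sin_div_cos, abs_of_nonneg (div_nonneg hsin0 (by linarith)),
      div_le_iff₀ (by linarith)]
    nlinarith
  rw [stableShift_two_sub, abs_mul]
  calc _ ≤ 1 * |Real.tan (Real.pi * Δ / 2)| := by gcongr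
    _ ≤ _ := by linarith

/-- First-order expansion of a stable density around the centred normal one, uniform in the index;
the error carries both a factor `Δ` and one power of `y` more than the main term. -/
theorem abs_stableDensity_sub_le {Δ β x : ℝ} (hΔ : 0 ≤ Δ) (hΔ1 : Δ ≤ 1 / 16) (hβ : |β| ≤ 1)
    (hx : 1 ≤ x - stableShift (2 - Δ) β) :
    |stableDensity (2 - Δ) β x - gaussPart (2 - Δ) β x -
      (1 + β) * (Real.sin (Real.pi * Δ / 2) * Real.Gamma (3 - Δ) / Real.pi) *
        (x - stableShift (2 - Δ) β) ^ (Δ - 3)| ≤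
      14 * (6 / Real.sin (1 / 4) ^ 4 + 120 / Real.sin (1 / 4) ^ 6) * Δ /
        (x - stableShift (2 - Δ) β) ^ 4 := by
  have h := abs_re_integral_stableKernel_sub_le hx hΔ hΔ1 (abs_stableShift_le hΔ hΔ1 hβ)
  have hcos : Real.cos (Real.pi * Δ / 2) ≠ 0 := by
    refine (Real.cos_pos_of_mem_Ioo ⟨?_, ?_⟩).ne' <;> nlinarith [Real.pi_pos]
  have hB : Real.sin (Real.pi * Δ / 2) + stableShift (2 - Δ) β * Real.cos (Real.pi * Δ / 2) =
      (1 + β) * Real.sin (Real.pi * Δ / 2) := by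
    rw [stableShift_two_sub, Real.tan_eq_sin_div_cos]
    field_simp
  rw [hB] at h
  rw [gaussPart, stableDensity_eq_integral_stableKernel (by linarith),
    normalTwoDensity_eq_integral_stableKernel]
  set y := x - stableShift (2 - Δ) β
  set A := (∫ u : ℝ, stableKernel y (2 - Δ) (stableShift (2 - Δ) β)
    (u - (0 : ℝ) * Complex.I)).re
  set A' := (∫ u : ℝ, stableKernel y 2 0 (u - (0 : ℝ) * Complex.I)).re
  have hpi : 0 < 1 / Real.pi := by positivity
  have hpi1 : 1 / Real.pi ≤ 1 := by
    rw [div_le_one Real.pi_pos]; linarith [Real.pi_gt_three]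
  have e : 1 / Real.pi * A - 1 / Real.pi * A' - (1 + β) * (Real.sin (Real.pi * Δ / 2) *
      Real.Gamma (3 - Δ) / Real.pi) * y ^ (Δ - 3) = 1 / Real.pi * (A - A' -
      (1 + β) * Real.sin (Real.pi * Δ / 2) * Real.Gamma (3 - Δ) * y ^ (Δ - 3)) := by ring
  rw [e, abs_mul, abs_of_pos hpi]
  exact (mul_le_of_le_one_left (abs_nonneg _) hpi1).trans h

/-- The coefficient `sin (πΔ/2) Γ(3 - Δ) / π` of the expansion is `Δ + o(Δ)`, which is how the simple
factor `Δ` of `tailPart` arises. -/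
theorem hasDerivAt_tailConstant :
    HasDerivAt (fun Δ : ℝ => Real.sin (Real.pi * Δ / 2) * Real.Gamma (3 - Δ) / Real.pi) 1 0 := by
  have hΓ : DifferentiableAt ℝ Real.Gamma (3 - 0) := by
    refine Real.differentiableAt_Gamma fun m => ?_
    have : (0 : ℝ) ≤ m := m.cast_nonneg
    intro h
    linarith
  have h1 : HasDerivAt (fun Δ : ℝ => Real.pi * Δ / 2) (Real.pi / 2) 0 := by
    simpa using ((hasDerivAt_id (0 : ℝ)).const_mul Real.pi).div_const 2
  have h2 := hΓ.hasDerivAt.comp (0 : ℝ) ((hasDerivAt_id (0 : ℝ)).const_sub 3)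
  have h3 := (h1.sin.mul h2).div_const Real.pi
  have g3 : Real.Gamma 3 = 2 := by
    rw [Real.Gamma_ofNat_eq_factorial 2]; norm_num [Nat.factorial]
  refine h3.congr_deriv ?_
  simp only [Function.comp, mul_zero, zero_div, Real.cos_zero, Real.sin_zero, sub_zero, g3]
  field_simp
  ring

theorem gaussPart_pos (α β x : ℝ) : 0 < gaussPart α β x := by
  unfold gaussPart normalTwoDensity
  have := Real.pi_pos
  positivity

theorem stableShift_neg (α β : ℝ) : stableShift α (-β) = -stableShift α β := by
  simp [stableShift]

theorem stableApprox_neg (α β x : ℝ) : stableApprox α (-β) (-x) = stableApprox α β x := by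
  have h : -x - stableShift α (-β) = -(x - stableShift α β) := by rw [stableShift_neg]; ring
  unfold stableApprox gaussPart tailPart normalTwoDensity
  rw [h, abs_neg, neg_sq, Left.sign_neg, SignType.coe_neg, neg_mul_neg]

/-- The ratio statement on the side `x > ζ`. -/
theorem stableDensity_div_stableApprox_right {β : ℝ} (hβ₁ : -1 < β) (hβ₂ : β < 1) {ε : ℝ}
    (hε : 0 < ε) : ∃ Δ₀ Y : ℝ, 0 < Δ₀ ∧ 1 ≤ Y ∧ ∀ Δ : ℝ, 0 ≤ Δ → Δ < Δ₀ → ∀ x : ℝ,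
      Y ≤ x - stableShift (2 - Δ) β →
        |stableDensity (2 - Δ) β x / stableApprox (2 - Δ) β x - 1| < ε := by
  have hd := hasDerivAt_iff_isLittleO.1 hasDerivAt_tailConstant
  have hd' := hd.def (by positivity : 0 < ε / 3)
  obtain ⟨r, hr, hball⟩ := Metric.eventually_nhds_iff.1 hd'
  set C : ℝ := 14 * (6 / Real.sin (1 / 4) ^ 4 + 120 / Real.sin (1 / 4) ^ 6) with hC
  have hC0 : 0 ≤ C := by
    have := Real.sin_pos_of_pos_of_lt_pi (x := 1 / 4) (by norm_num) (by linarith [Real.pi_gt_three])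
    positivity
  have hb : 0 < 1 + β := by linarith
  refine ⟨min r (1 / 16), max 1 (C / ((1 + β) * (ε / 3))), lt_min hr (by norm_num),
    le_max_left _ _, fun Δ hΔ hΔ' x hx => ?_⟩
  have hΔ1 : Δ ≤ 1 / 16 := (hΔ'.trans_le (min_le_right _ _)).le
  have hq : |Real.sin (Real.pi * Δ / 2) * Real.Gamma (3 - Δ) / Real.pi - Δ| ≤ ε / 3 * Δ := by
    have := hball (y := Δ) (by simpa [abs_of_nonneg hΔ] using hΔ'.trans_le (min_le_left _ _))
    simpa [abs_of_nonneg hΔ] using this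
  have hy1 := (le_max_left _ _).trans hx
  have hyC := (le_max_right _ _).trans hx
  have hmain := abs_stableDensity_sub_le hΔ hΔ1 (abs_le.2 ⟨hβ₁.le, hβ₂.le⟩) hy1
  have hG := gaussPart_pos (2 - Δ) β x
  rw [← hC] at hmain
  set q := Real.sin (Real.pi * Δ / 2) * Real.Gamma (3 - Δ) / Real.pi
  have htail : tailPart (2 - Δ) β x =
      (1 + β) * Δ * (x - stableShift (2 - Δ) β) ^ (Δ - 3) := by
    have hy0 : 0 < x - stableShift (2 - Δ) β := by linarith
    rw [tailPart, sign_pos hy0, abs_of_pos hy0]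
    simp
  set y := x - stableShift (2 - Δ) β
  have hy0 : 0 < y := by linarith
  have hp : 0 < y ^ (Δ - 3) := Real.rpow_pos_of_pos hy0 _
  have hp3 : 1 / y ^ 3 ≤ y ^ (Δ - 3) := by
    have : 1 / y ^ 3 = y ^ (-3 : ℝ) := by
      rw [Real.rpow_neg hy0.le, one_div]; norm_cast
    rw [this]
    exact Real.rpow_le_rpow_of_exponent_le hy1 (by linarith)
  have hT : 0 ≤ tailPart (2 - Δ) β x := by rw [htail]; positivity
  have hrem : C * Δ / y ^ 4 ≤ ε / 3 * tailPart (2 - Δ) β x := by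
    have h1 : C / y ≤ (1 + β) * (ε / 3) := by
      rw [div_le_iff₀ (by positivity)] at hyC
      rw [div_le_iff₀ hy0]
      linarith
    calc C * Δ / y ^ 4 = C / y * Δ * (1 / y ^ 3) := by field_simp
      _ ≤ ((1 + β) * (ε / 3)) * Δ * y ^ (Δ - 3) := by gcongr
      _ = _ := by rw [htail]; ring
  have hlin : |(1 + β) * q * y ^ (Δ - 3) - tailPart (2 - Δ) β x| ≤
      ε / 3 * tailPart (2 - Δ) β x := by
    have : (1 + β) * q * y ^ (Δ - 3) - tailPart (2 - Δ) β x =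
        (1 + β) * y ^ (Δ - 3) * (q - Δ) := by rw [htail]; ring
    rw [this, abs_mul, abs_of_pos (mul_pos hb hp)]
    calc _ ≤ (1 + β) * y ^ (Δ - 3) * (ε / 3 * Δ) := by gcongr
      _ = _ := by rw [htail]; ring
  have hg : 0 < stableApprox (2 - Δ) β x := by unfold stableApprox; linarith
  rw [div_sub_one hg.ne', abs_div, abs_of_pos hg, div_lt_iff₀ hg]
  have htri : |stableDensity (2 - Δ) β x - stableApprox (2 - Δ) β x| ≤
      C * Δ / y ^ 4 + ε / 3 * tailPart (2 - Δ) β x := by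
    have e : stableDensity (2 - Δ) β x - stableApprox (2 - Δ) β x =
        (stableDensity (2 - Δ) β x - gaussPart (2 - Δ) β x - (1 + β) * q * y ^ (Δ - 3)) +
        ((1 + β) * q * y ^ (Δ - 3) - tailPart (2 - Δ) β x) := by unfold stableApprox; ring
    rw [e]
    exact (abs_add_le _ _).trans (add_le_add hmain hlin)
  have hεg : ε * stableApprox (2 - Δ) β x =
      ε * gaussPart (2 - Δ) β x + ε * tailPart (2 - Δ) β x := mul_add _ _ _
  linarith [mul_pos hε hG, mul_nonneg hε.le hT]

theorem stableDensity_div_stableApprox {β : ℝ} (hβ₁ : -1 < β) (hβ₂ : β < 1) {ε : ℝ}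
    (hε : 0 < ε) : ∃ Δ₀ x₀ : ℝ, 0 < Δ₀ ∧ 0 < x₀ ∧
      ∀ Δ : ℝ, 0 ≤ Δ → Δ < Δ₀ → ∀ x : ℝ, x₀ < |x| →
        |stableDensity (2 - Δ) β x / stableApprox (2 - Δ) β x - 1| < ε := by
  obtain ⟨D₁, Y₁, hD₁, hY₁, H₁⟩ := stableDensity_div_stableApprox_right hβ₁ hβ₂ hε
  obtain ⟨D₂, Y₂, hD₂, hY₂, H₂⟩ :=
    stableDensity_div_stableApprox_right (β := -β) (by linarith) (by linarith) hε
  refine ⟨min (min D₁ D₂) (1 / 16), max Y₁ Y₂ + 1,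
    lt_min (lt_min hD₁ hD₂) (by norm_num), by linarith [le_max_left Y₁ Y₂], ?_⟩
  intro Δ hΔ hΔ' x hx
  have hΔ1 : Δ ≤ 1 / 16 := (hΔ'.trans_le (min_le_right _ _)).le
  have hΔ2 := hΔ'.trans_le (min_le_left _ _)
  have hζ := abs_le.1 (abs_stableShift_le hΔ hΔ1 (abs_le.2 ⟨hβ₁.le, hβ₂.le⟩))
  have hm1 := le_max_left Y₁ Y₂
  have hm2 := le_max_right Y₁ Y₂
  rcases lt_abs.1 hx with h | h
  · exact H₁ Δ hΔ (hΔ2.trans_le (min_le_left _ _)) x (by linarith [hζ.2])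
  · have := H₂ Δ hΔ (hΔ2.trans_le (min_le_right _ _)) (-x)
      (by rw [stableShift_neg]; linarith [hζ.1])
    rwa [stableDensity_neg, stableApprox_neg] at this

/-! ### Comparison of the normal and the tail term -/

theorem rpow_eq_exp_neg_log_inv {Δ : ℝ} (hΔ : 0 < Δ) (s : ℝ) :
    Δ ^ s = Real.exp (-(s * Real.log (1 / Δ))) := by
  rw [Real.rpow_def_of_pos hΔ, one_div, Real.log_inv]
  congr 1
  ring

theorem tailPart_div_gaussPart_le {Δ β δ a x : ℝ} (hΔ : 0 < Δ) (hΔ1 : Δ < 1) (hβ : |β| ≤ 1)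
    (ha : 0 < a) (ha1 : a ≤ 1) (hax : a ≤ |x - stableShift (2 - Δ) β|)
    (hx : |x - stableShift (2 - Δ) β| ≤ (2 - δ) * Real.sqrt (Real.log (1 / Δ))) :
    |tailPart (2 - Δ) β x / gaussPart (2 - Δ) β x| ≤
      4 * Real.sqrt Real.pi * a ^ (-3 : ℝ) * Δ ^ (δ / 2 * (1 - δ / 2)) * Δ ^ (δ / 2) := by
  set y := x - stableShift (2 - Δ) β with hy
  have hL : 0 ≤ Real.log (1 / Δ) := Real.log_nonneg (by rw [le_div_iff₀ hΔ]; linarith)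
  have hsq : y ^ 2 / 4 ≤ (1 - δ / 2) ^ 2 * Real.log (1 / Δ) := by
    have h1 : |y| ^ 2 ≤ ((2 - δ) * Real.sqrt (Real.log (1 / Δ))) ^ 2 := by gcongr
    rw [sq_abs, mul_pow, Real.sq_sqrt hL] at h1
    nlinarith
  have hpow : |y| ^ ((2 - (2 - Δ)) - 3) ≤ a ^ (-3 : ℝ) :=
    calc _ ≤ a ^ ((2 - (2 - Δ)) - 3) := Real.rpow_le_rpow_of_nonpos ha hax (by linarith)
      _ ≤ _ := Real.rpow_le_rpow_of_exponent_ge ha ha1 (by linarith)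
  have hsgn : |1 + β * (SignType.sign y : ℝ)| ≤ 2 := by
    have hs : |(SignType.sign y : ℝ)| ≤ 1 := by
      rcases lt_trichotomy y 0 with h | h | h
      · rw [sign_neg h]; simp
      · rw [h]; simp
      · rw [sign_pos h]; simp
    refine (abs_add_le _ _).trans ?_
    rw [abs_one, abs_mul]
    nlinarith [abs_nonneg β, abs_nonneg (SignType.sign y : ℝ)]
  have hsp : 0 < Real.sqrt Real.pi := Real.sqrt_pos.2 Real.pi_pos
  have e : tailPart (2 - Δ) β x / gaussPart (2 - Δ) β x =
      (1 + β * (SignType.sign y : ℝ)) *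
        (Δ * |y| ^ ((2 - (2 - Δ)) - 3) * (2 * Real.sqrt Real.pi) * Real.exp (y ^ 2 / 4)) := by
    have hE : Real.exp (-y ^ 2 / 4) = (Real.exp (y ^ 2 / 4))⁻¹ := by
      rw [← Real.exp_neg]; congr 1; ring
    rw [tailPart, gaussPart, normalTwoDensity, ← hy, hE]
    have := Real.exp_pos (y ^ 2 / 4)
    field_simp
    ring
  have hexp : Δ * Real.exp (y ^ 2 / 4) ≤ Δ ^ (δ / 2 * (1 - δ / 2)) * Δ ^ (δ / 2) := by
    have h1 : Δ = Δ ^ (1 : ℝ) := (Real.rpow_one Δ).symm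
    conv_lhs => rw [h1]
    rw [rpow_eq_exp_neg_log_inv hΔ, rpow_eq_exp_neg_log_inv hΔ, rpow_eq_exp_neg_log_inv hΔ,
      ← Real.exp_add, ← Real.exp_add]
    refine Real.exp_le_exp.2 ?_
    linarith
  have hnn : 0 ≤ |y| ^ ((2 - (2 - Δ)) - 3) := Real.rpow_nonneg (abs_nonneg _) _
  rw [e, abs_mul, abs_of_nonneg (a := Δ * _ * _ * _) (by positivity)]
  calc _ ≤ 2 * (Δ * a ^ (-3 : ℝ) * (2 * Real.sqrt Real.pi) * Real.exp (y ^ 2 / 4)) := by gcongr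
    _ = 4 * Real.sqrt Real.pi * a ^ (-3 : ℝ) * (Δ * Real.exp (y ^ 2 / 4)) := by ring
    _ ≤ 4 * Real.sqrt Real.pi * a ^ (-3 : ℝ) * (Δ ^ (δ / 2 * (1 - δ / 2)) * Δ ^ (δ / 2)) := by
      gcongr
    _ = _ := by ring

/-- Any small multiple of the Gaussian exponent absorbs the power `y ^ (3 - Δ)`, uniformly in `Δ`. -/
theorem rpow_three_sub_le {Δ κ y : ℝ} (hΔ : 0 ≤ Δ) (hΔ1 : Δ ≤ 1) (hκ : 0 < κ) (hy : 0 ≤ y) :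
    y ^ (3 - Δ) ≤ (1 + 32 / κ ^ 2) * Real.exp (κ * (y ^ 2 / 4)) := by
  have hE : 1 ≤ Real.exp (κ * (y ^ 2 / 4)) := Real.one_le_exp (by positivity)
  have hq := Real.quadratic_le_exp_of_nonneg (x := κ * (y ^ 2 / 4)) (by positivity)
  have h4 : y ^ 4 ≤ 32 / κ ^ 2 * Real.exp (κ * (y ^ 2 / 4)) := by
    have h : (κ * (y ^ 2 / 4)) ^ 2 / 2 ≤ Real.exp (κ * (y ^ 2 / 4)) := by
      have : 0 ≤ κ * (y ^ 2 / 4) := by positivity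
      linarith
    calc y ^ 4 = 32 / κ ^ 2 * ((κ * (y ^ 2 / 4)) ^ 2 / 2) := by field_simp; ring
      _ ≤ _ := by gcongr
  have h1 : y ^ (3 - Δ) ≤ 1 + y ^ 4 := by
    rcases le_total y 1 with h | h
    · have := Real.rpow_le_one hy h (by linarith : 0 ≤ 3 - Δ)
      have : 0 ≤ y ^ 4 := by positivity
      linarith
    · have : y ^ (3 - Δ) ≤ y ^ ((4 : ℕ) : ℝ) :=
        Real.rpow_le_rpow_of_exponent_le h (by push_cast; linarith)
      rw [Real.rpow_natCast] at this
      linarith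
  rw [add_mul]
  linarith

theorem gaussPart_div_tailPart_le {Δ β δ x : ℝ} (hΔ : 0 < Δ) (hΔ1 : Δ < 1) (hβ : |β| < 1)
    (hδ : 0 < δ) (hx : (2 + δ) * Real.sqrt (Real.log (1 / Δ)) ≤ |x - stableShift (2 - Δ) β|) :
    0 < tailPart (2 - Δ) β x ∧ gaussPart (2 - Δ) β x / tailPart (2 - Δ) β x ≤
      (1 + 32 / (1 - (1 + 3 * δ / 4) / (1 + δ / 2) ^ 2) ^ 2) / (1 - |β|) * Δ ^ (δ / 4) *
        Δ ^ (δ / 2) := by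
  set r := (1 + 3 * δ / 4) / (1 + δ / 2) ^ 2 with hr
  have hr0 : 0 < r := by positivity
  have hr1 : 0 < 1 - r := by
    rw [sub_pos, hr, div_lt_one (by positivity)]
    nlinarith
  set y := x - stableShift (2 - Δ) β with hy
  have hL : 0 < Real.log (1 / Δ) := Real.log_pos (by rw [lt_div_iff₀ hΔ]; linarith)
  have hy0 : 0 < |y| := lt_of_lt_of_le (by positivity) hx
  have hb : 0 < 1 - |β| := by linarith
  have hsgn : 1 - |β| ≤ 1 + β * (SignType.sign y : ℝ) := by
    rcases lt_or_gt_of_ne (abs_pos.1 hy0) with h | h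
    · rw [sign_neg h]
      simp only [SignType.coe_neg_one]
      linarith [le_abs_self β]
    · rw [sign_pos h]
      simp only [SignType.coe_one]
      linarith [neg_abs_le β]
  have hp : 0 < |y| ^ (Δ - 3) := Real.rpow_pos_of_pos hy0 _
  have htail : (1 - |β|) * Δ * |y| ^ (Δ - 3) ≤ tailPart (2 - Δ) β x := by
    rw [tailPart, ← hy, show 2 - (2 - Δ) = Δ by ring]
    gcongr
  have hpos : 0 < (1 - |β|) * Δ * |y| ^ (Δ - 3) := by positivity
  refine ⟨hpos.trans_le htail, ?_⟩
  have hgauss : gaussPart (2 - Δ) β x ≤ Real.exp (-(y ^ 2 / 4)) := by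
    rw [gaussPart, normalTwoDensity, ← hy, show -y ^ 2 / 4 = -(y ^ 2 / 4) by ring]
    have h1 : 1 / (2 * Real.sqrt Real.pi) ≤ 1 := by
      have : 1 ≤ Real.sqrt Real.pi := Real.one_le_sqrt.2 (by linarith [Real.pi_gt_three])
      rw [div_le_one (by positivity)]
      linarith
    calc _ ≤ 1 * Real.exp (-(y ^ 2 / 4)) := by gcongr
      _ = _ := one_mul _
  have hsq : (1 + 3 * δ / 4) * Real.log (1 / Δ) ≤ r * (y ^ 2 / 4) := by
    have h1 : ((2 + δ) * Real.sqrt (Real.log (1 / Δ))) ^ 2 ≤ |y| ^ 2 := by gcongr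
    rw [sq_abs, mul_pow, Real.sq_sqrt hL.le] at h1
    calc _ = r * ((2 + δ) ^ 2 * Real.log (1 / Δ) / 4) := by rw [hr]; field_simp; ring
      _ ≤ _ := by gcongr
  -- The share `1 - r` of the Gaussian exponent pays for the power of `|y|`.
  have hpw := rpow_three_sub_le hΔ.le hΔ1.le hr1 hy0.le
  rw [sq_abs] at hpw
  have hinv : |y| ^ (3 - Δ) = (|y| ^ (Δ - 3))⁻¹ := by
    rw [← Real.rpow_neg hy0.le]; congr 1; ring
  have hEr : Real.exp (-(r * (y ^ 2 / 4))) ≤ Δ * (Δ ^ (δ / 4) * Δ ^ (δ / 2)) := by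
    have h1 : Δ * (Δ ^ (δ / 4) * Δ ^ (δ / 2)) = Δ ^ (1 + 3 * δ / 4) := by
      rw [← Real.rpow_add hΔ, ← Real.rpow_one_add' hΔ.le (by positivity)]
      congr 1; ring
    rw [h1, rpow_eq_exp_neg_log_inv hΔ]
    exact Real.exp_le_exp.2 (by linarith)
  set K := 1 + 32 / (1 - r) ^ 2
  have hK : 0 < K := by positivity
  calc gaussPart (2 - Δ) β x / tailPart (2 - Δ) β x
      ≤ Real.exp (-(y ^ 2 / 4)) / ((1 - |β|) * Δ * |y| ^ (Δ - 3)) := by gcongr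
    _ = Real.exp (-(y ^ 2 / 4)) * |y| ^ (3 - Δ) / ((1 - |β|) * Δ) := by
      rw [hinv]; field_simp
    _ ≤ Real.exp (-(y ^ 2 / 4)) * (K * Real.exp ((1 - r) * (y ^ 2 / 4))) / ((1 - |β|) * Δ) := by
      gcongr
    _ = K * Real.exp (-(r * (y ^ 2 / 4))) / ((1 - |β|) * Δ) := by
      rw [mul_left_comm, ← Real.exp_add]
      congr 3
      ring
    _ ≤ K * (Δ * (Δ ^ (δ / 4) * Δ ^ (δ / 2))) / ((1 - |β|) * Δ) := by gcongr
    _ = _ := by field_simp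

open Filter Topology in
theorem eventually_const_mul_rpow_le (K : ℝ) {s η : ℝ} (hs : 0 < s) (hη : 0 < η) :
    ∀ᶠ Δ in 𝓝[>] (0 : ℝ), K * Δ ^ s ≤ η := by
  have h : Tendsto (fun Δ : ℝ => K * Δ ^ s) (𝓝[>] 0) (𝓝 0) := by
    have h1 : ContinuousAt (fun Δ : ℝ => K * Δ ^ s) 0 :=
      (Real.continuousAt_rpow_const 0 s (Or.inr hs.le)).const_mul K
    have h2 := h1.tendsto
    simp only [Real.zero_rpow hs.ne', mul_zero] at h2
    exact h2.mono_left nhdsWithin_le_nhds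
  exact h.eventually_le_const hη

open Filter Topology in
/-- The two regimes of `g`. For `|y| ≤ (2 - δ) √L`, `L = log (1 / Δ)`, the tail term is at most
`Δ exp (y² / 4) ≤ Δ ^ (δ - δ² / 4)` times the normal one up to a constant, while for
`|y| ≥ (2 + δ) √L` the normal term is at most a constant times `Δ ^ (1 + 3δ/4) |y| ^ (Δ - 3)`. -/
theorem stableApprox_regimes {β : ℝ} (hβ₁ : -1 < β) (hβ₂ : β < 1) :
    ∀ δ : ℝ, 0 < δ → ∀ x₀ : ℝ, 0 < x₀ → ∀ η : ℝ, 0 < η → ∃ Δ₁ : ℝ, 0 < Δ₁ ∧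
      ∀ Δ : ℝ, 0 < Δ → Δ < Δ₁ → ∀ x : ℝ, x₀ < |x| →
        (|x - stableShift (2 - Δ) β| ≤ (2 - δ) * Real.sqrt (Real.log (1 / Δ)) →
          |stableApprox (2 - Δ) β x / gaussPart (2 - Δ) β x - 1| ≤ η * Δ ^ (δ / 2)) ∧
        ((2 + δ) * Real.sqrt (Real.log (1 / Δ)) ≤ |x - stableShift (2 - Δ) β| →
          |stableApprox (2 - Δ) β x / tailPart (2 - Δ) β x - 1| ≤ η * Δ ^ (δ / 2)) := by
  intro δ hδ x₀ hx₀ η hη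
  have hβ : |β| < 1 := abs_lt.2 ⟨hβ₁, hβ₂⟩
  set a := min (x₀ / 2) 1 with ha
  have ha0 : 0 < a := lt_min (by linarith) one_pos
  have hbd : ∀ᶠ Δ in 𝓝[>] (0 : ℝ), Δ < min (1 / 16) (x₀ / 8) :=
    (eventually_lt_nhds (lt_min (by norm_num) (by linarith))).filter_mono nhdsWithin_le_nhds
  have hc1 : ∀ᶠ Δ in 𝓝[>] (0 : ℝ), δ < 2 →
      4 * Real.sqrt Real.pi * a ^ (-3 : ℝ) * Δ ^ (δ / 2 * (1 - δ / 2)) ≤ η := by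
    by_cases h : δ < 2
    · filter_upwards [eventually_const_mul_rpow_le (4 * Real.sqrt Real.pi * a ^ (-3 : ℝ))
        (s := δ / 2 * (1 - δ / 2)) (mul_pos (by linarith) (by linarith)) hη] with Δ hΔ _ using hΔ
    · exact Eventually.of_forall fun _ h' => absurd h' h
  have hc2 := eventually_const_mul_rpow_le
    ((1 + 32 / (1 - (1 + 3 * δ / 4) / (1 + δ / 2) ^ 2) ^ 2) / (1 - |β|)) (s := δ / 4)
    (by linarith) hη
  obtain ⟨Δ₁, hΔ₁, hsub⟩ := mem_nhdsGT_iff_exists_Ioo_subset.1 (hbd.and (hc1.and hc2))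
  refine ⟨Δ₁, hΔ₁, fun Δ hΔ hΔ' x hx => ?_⟩
  obtain ⟨h1, h2, h3⟩ := hsub ⟨hΔ, hΔ'⟩
  have hΔ16 : Δ < 1 / 16 := h1.trans_le (min_le_left _ _)
  have hΔx : Δ < x₀ / 8 := h1.trans_le (min_le_right _ _)
  have hΔ1 : Δ < 1 := by linarith
  have hζ := abs_stableShift_le hΔ.le hΔ16.le hβ.le
  have hax : a ≤ |x - stableShift (2 - Δ) β| := by
    have := abs_sub_abs_le_abs_sub x (stableShift (2 - Δ) β)
    have := min_le_left (x₀ / 2) 1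
    linarith
  have hΔδ : 0 < Δ ^ (δ / 2) := Real.rpow_pos_of_pos hΔ _
  refine ⟨fun hle => ?_, fun hle => ?_⟩
  · -- Since `x ≠ ζ`, the first regime is empty unless `δ < 2`.
    have hδ2 : δ < 2 := by
      by_contra h
      have : (2 - δ) * Real.sqrt (Real.log (1 / Δ)) ≤ 0 :=
        mul_nonpos_of_nonpos_of_nonneg (by linarith) (Real.sqrt_nonneg _)
      linarith
    have hG := (gaussPart_pos (2 - Δ) β x).ne'
    rw [stableApprox, add_div, div_self hG, add_sub_cancel_left]
    refine (tailPart_div_gaussPart_le hΔ hΔ1 hβ.le ha0 (min_le_right _ _) hax hle).trans ?_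
    gcongr
    exact h2 hδ2
  · obtain ⟨hT, hq⟩ := gaussPart_div_tailPart_le hΔ hΔ1 hβ hδ hle
    rw [stableApprox, add_div, div_self hT.ne', add_sub_cancel_right,
      abs_of_pos (div_pos (gaussPart_pos _ _ _) hT)]
    refine hq.trans ?_
    gcongr

theorem mainTheorem2 (β : ℝ) (hβ₁ : -1 < β) (hβ₂ : β < 1) :
    (∀ ε : ℝ, 0 < ε → ∃ Δ₀ x₀ : ℝ, 0 < Δ₀ ∧ 0 < x₀ ∧
      ∀ Δ : ℝ, 0 ≤ Δ → Δ < Δ₀ → ∀ x : ℝ, x₀ < |x| →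
        |stableDensity (2 - Δ) β x / stableApprox (2 - Δ) β x - 1| < ε) ∧
    (∀ δ : ℝ, 0 < δ → ∀ x₀ : ℝ, 0 < x₀ → ∀ η : ℝ, 0 < η → ∃ Δ₁ : ℝ, 0 < Δ₁ ∧
      ∀ Δ : ℝ, 0 < Δ → Δ < Δ₁ → ∀ x : ℝ, x₀ < |x| →
        (|x - stableShift (2 - Δ) β| ≤ (2 - δ) * Real.sqrt (Real.log (1 / Δ)) →
          |stableApprox (2 - Δ) β x / gaussPart (2 - Δ) β x - 1| ≤ η * Δ ^ (δ / 2)) ∧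
        ((2 + δ) * Real.sqrt (Real.log (1 / Δ)) ≤ |x - stableShift (2 - Δ) β| →
          |stableApprox (2 - Δ) β x / tailPart (2 - Δ) β x - 1| ≤ η * Δ ^ (δ / 2))) :=
  ⟨fun _ hε => stableDensity_div_stableApprox hβ₁ hβ₂ hε, stableApprox_regimes hβ₁ hβ₂⟩
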